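/- Let $(\Omega,\mathcal A,\mu)$ be a probability space, $T:\Omega\to\Omega$ a measurable map preserving $\mu$ which is mixing, i.e. $\mu(A\cap T^{-n}B)\to\mu(A)\mu(B)$ for all $A,B\in\mathcal A$. Let $\widehat T:\mathcal L^1\to\mathcal L^1$ be its transfer operator, determined by $\int \widehat Tf\cdot g\,d\mu=\int f\cdot (g\circ T)\,d\mu$ for $f\in\mathcal L^1$, $g\in\mathcal L^\infty$. Let $(\mathcal F,\|\cdot\|)$ be a complex Banach algebra of ($\mu$-a.e. classes of) measurable functions $\Omega\to\mathbb C$ with pointwise operations, which contains the constant functions and satisfies $\|f\|\ge |f|_\infty$ for all $f\in\mathcal F$, where $|\cdot|_\infty$ is the essential supremum norm. Assume that $\widehat T$ maps $\mathcal F$ into $\mathcal F$, is bounded with respect to $\|\cdot\|$, and has a spectral gap on $\mathcal F$: $\widehat T|_{\mathcal F}=\lambda P+N$ with $\lambda\in\mathbb C$ and bounded linear operators $P,N$ on $\mathcal F$ such that $P^2=P$, $\dim P(\mathcal F)=1$, $PN=NP=0$, and the spectral radius of $N$ is strictly less than $|\lambda|$. Let $\chi:\Omega\to\mathbb R_{\ge0}$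 be measurable and not $\mu$-almost everywhere equal to $0$. Assume that for all $\ell>0$ the functions $\chi\cdot\mathbf 1_{\{\chi\le\ell\}}$ and $\mathbf 1_{\{\chi>\ell\}}$ belong to $\mathcal F$, and that there are constants $K_1,K_2>0$ such that $$\|\chi\cdot\mathbf 1_{\{\chi\le\ell\}}\|\le K_1\,\ell,\qquad \|\mathbf 1_{\{\chi>\ell\}}\|\le K_2\qquad\text{for all }\ell>0.$$ For $n\in\mathbb N$, $b\in\mathbb N_0$ and $x\in\Omega$ choose a permutation $\sigma$ of $\{0,\dots,n-1\}$ with $\chi(T^{\sigma(0)}x)\ge\chi(T^{\sigma(1)}x)\ge\dots\ge\chi(T^{\sigma(n-1)}x)$ and put $\mathsf S_n^{b}\chi(x)=\sum_{k=b}^{n-1}\chi(T^{\sigma(k)}x)$, the Birkhoff sum without its $b$ largest summands. Then there exist a sequence $(b_n)$ of positive integers with $b_n\to\infty$ and $b_n=o(n)$, and a sequence $(d_n)$ of positive reals, such that $$\lim_{n\to\infty}\frac{\mathsf S_n^{b_n}\chi}{d_n}=1\qquad\mu\text{-almost surely.}$$ -/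

import Mathlib

open MeasureTheory Filter Topology Asymptotics
open scoped ENNReal

noncomputable section

namespace TrimmedBirkhoff

/-- The trimmed Birkhoff sum `S_n^b χ (x)`. Let `σ` be a permutation of `{0, …, n-1}` which puts the
values `χ (T^k x)`, `k < n`, in non-increasing order (here `Tuple.sort` sorts their negatives in
non-decreasing order); then `S_n^b χ (x) = ∑_{k=b}^{n-1} χ (T^{σ(k)} x)`. The value does not depend
on the choice of `σ`, see `trimmedSum_eq`. -/
def trimmedSum {Ω : Type*} (T : Ω → Ω) (χ : Ω → ℝ) (b n : ℕ) (x : Ω) : ℝ :=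
  ∑ k : Fin n with b ≤ k.val,
    χ (T^[(Tuple.sort (fun j : Fin n => -χ (T^[(j : ℕ)] x)) k : ℕ)] x)

/-- Every ordering permutation gives the same trimmed sum. -/
theorem trimmedSum_eq {Ω : Type*} (T : Ω → Ω) (χ : Ω → ℝ) (b n : ℕ) (x : Ω)
    (σ : Equiv.Perm (Fin n)) (hσ : Antitone (fun k : Fin n => χ (T^[(σ k : ℕ)] x))) :
    trimmedSum T χ b n x = ∑ k : Fin n with b ≤ k.val, χ (T^[(σ k : ℕ)] x) := by
  have h := Tuple.unique_monotone (f := fun j : Fin n => -χ (T^[(j : ℕ)] x))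
    (σ := Tuple.sort (fun j : Fin n => -χ (T^[(j : ℕ)] x))) (τ := σ)
    (Tuple.monotone_sort _) (fun i j hij => neg_le_neg (hσ hij))
  refine Finset.sum_congr rfl fun k _ => ?_
  have hk := congrFun h k
  simpa using hk

/-- `h` is the image of `f ∈ L¹` under the transfer operator of `T`: `h` is the (a.e. unique)
integrable function with `∫ h · g dμ = ∫ f · (g ∘ T) dμ` for all `g ∈ L^∞`. -/
def IsTransferImage {Ω : Type*} [MeasurableSpace Ω] (μ : Measure Ω) (T : Ω → Ω)
    (f h : Ω → ℂ) : Prop :=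
  Integrable f μ ∧ Integrable h μ ∧
    ∀ g : Ω → ℂ, MemLp g ∞ μ → ∫ x, h x * g x ∂μ = ∫ x, f x * g (T x) ∂μ

/-- A measure-preserving map is (strongly) mixing: `μ (A ∩ T⁻ⁿ B) → μ A · μ B` for all measurable
sets `A`, `B`. -/
def IsMixing {Ω : Type*} [MeasurableSpace Ω] (μ : Measure Ω) (T : Ω → Ω) : Prop :=
  ∀ A B : Set Ω, MeasurableSet A → MeasurableSet B →
    Tendsto (fun n : ℕ => μ (A ∩ T^[n] ⁻¹' B)) atTop (𝓝 (μ A * μ B))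

/-- A bounded operator `U` on a complex Banach space has a spectral gap: `U = lam • P + N` with
bounded operators `P`, `N`, where `P` is a projection of rank one, the spectral radius of `N` is
strictly less than `|lam|`, and `P N = N P = 0`. -/
def HasSpectralGap {F : Type*} [NormedAddCommGroup F] [NormedSpace ℂ F] (U : F →L[ℂ] F) : Prop :=
  ∃ (lam : ℂ) (P N : F →L[ℂ] F),
    U = lam • P + N ∧
    P ∘L P = P ∧ Module.finrank ℂ (LinearMap.range (P : F →ₗ[ℂ] F)) = 1 ∧
    spectralRadius ℂ N < ‖lam‖ₑ ∧
    P ∘L N = 0 ∧ N ∘L P = 0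

/-- Property C of the system `(Ω, μ, T, F, ‖·‖)`. The complex Banach algebra `F` of (a.e. classes of)
measurable functions is given with the map `ι` that sends an element to the class it is; `ι` is
linear, injective and multiplicative for the pointwise operations, and `ι 1 = 1`, so that `F`
contains the constant functions. The transfer operator maps `F` into itself, is bounded there and has a
spectral gap. -/
structure PropertyC {Ω F : Type*} [MeasurableSpace Ω] (μ : Measure Ω) (T : Ω → Ω)
    [NormedCommRing F] [NormedAlgebra ℂ F] (ι : F →ₗ[ℂ] (Ω →ₘ[μ] ℂ)) : Prop where
  /-- The measure is invariant under `T`. -/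
  measurePreserving : MeasurePreserving T μ μ
  /-- The system is mixing. -/
  mixing : IsMixing μ T
  /-- Elements of `F` are a.e. classes of functions. -/
  injective : Function.Injective ι
  /-- Multiplication in `F` is pointwise multiplication. -/
  map_mul : ∀ f g : F, ι (f * g) = ι f * ι g
  /-- `F` contains the constant functions (the constant `c` is `ι (c • 1)`). -/
  map_one : ι 1 = 1
  /-- The norm dominates the essential supremum norm. -/
  norm_bound : ∀ f : F, eLpNorm (ι f) ∞ μ ≤ ‖f‖ₑ
  /-- The transfer operator restricts to a bounded operator on `F` with a spectral gap. -/
  transfer : ∃ U : F →L[ℂ] F, (∀ f : F, IsTransferImage μ T (ι f) (ι (U f))) ∧ HasSpectralGap U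

/-- Property D of the system `(Ω, μ, T, F, ‖·‖, χ)`: Property C holds, `χ` is measurable and
non-negative, the truncations `χ · 1_{χ ≤ ℓ}` and the indicators `1_{χ > ℓ}`, `ℓ > 0`, belong to
`F`, and their norms are at most `K₁ ℓ` and `K₂`. -/
structure PropertyD {Ω F : Type*} [MeasurableSpace Ω] (μ : Measure Ω) (T : Ω → Ω)
    [NormedCommRing F] [NormedAlgebra ℂ F] (ι : F →ₗ[ℂ] (Ω →ₘ[μ] ℂ)) (χ : Ω → ℝ) : Prop where
  /-- The underlying system has Property C. -/
  propertyC : PropertyC μ T ι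
  /-- The observable is measurable. -/
  measurable : Measurable χ
  /-- The observable is non-negative. -/
  nonneg : ∀ x, 0 ≤ χ x
  /-- The truncations of `χ` grow at most linearly in norm. -/
  truncation : ∃ K₁ : ℝ, 0 < K₁ ∧ ∀ l : ℝ, 0 < l → ∃ f : F,
    (ι f =ᵐ[μ] fun x => ((Set.indicator {y | χ y ≤ l} χ x : ℝ) : ℂ)) ∧ ‖f‖ ≤ K₁ * l
  /-- The indicators of the sets `{χ > l}` are bounded in norm. -/
  indicator : ∃ K₂ : ℝ, 0 < K₂ ∧ ∀ l : ℝ, 0 < l → ∃ f : F,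
    (ι f =ᵐ[μ] Set.indicator {y | l < χ y} (fun _ => (1 : ℂ))) ∧ ‖f‖ ≤ K₂

end TrimmedBirkhoff

end

/-! Fix a level l. The spectral gap forces the leading eigenvalue to be 1 and the projection to be
the expectation, so the iterates of the transfer operator on `F` converge to the mean with summable
errors (`PropertyC.exists_summable_norm_pow_sub`). Hence bounded nonnegative observables
representing elements of `F` have summable correlations and obey a strong law
(`PropertyC.tendsto_birkhoffSum_div`). It applies to χ·1_{χ ≤ l}, with mean m, and to 1_{χ > l},
with mean p.

Suppose that at time n both Birkhoff averages are within ε of their means. Trimming slightly more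
than n(p + ε) entries removes every value above l, and besides these only O(nε) values, each at most
l. So the trimmed sum differs from n m by O(nεl) (`abs_trimmedSum_sub_le`).

Now let levels L j tend to infinity, with ε j · L j → 0. The means m j stay bounded below, so the
relative error vanishes, and p j → 0 makes the number of trimmed entries o(n). No uniformity of the
strong law in j is needed: `exists_slow_diagonal` lets j = J n grow so slowly that, by
Borel–Cantelli, almost every orbit is eventually ε (J n)-close to both means at time n. -/

theorem summable_norm_pow_of_spectralRadius_lt_one {A : Type*} [NormedRing A] [NormedAlgebra ℂ A]
    [CompleteSpace A] {a : A} (h : spectralRadius ℂ a < 1) : Summable fun n : ℕ => ‖a ^ n‖ := by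
  obtain ⟨r, hr, hr1⟩ := ENNReal.lt_iff_exists_nnreal_btwn.1 h
  have hr1' : r < 1 := by exact_mod_cast hr1
  refine Summable.of_norm_bounded_eventually_nat (g := fun n => (r : ℝ) ^ n)
    (summable_geometric_of_lt_one r.2 (by exact_mod_cast hr1')) ?_
  -- Gelfand's formula followed by the root test.
  have ht := spectrum.pow_norm_pow_one_div_tendsto_nhds_spectralRadius a
  filter_upwards [ht.eventually_lt_const hr, eventually_gt_atTop 0] with n hn hn0
  rw [norm_norm]
  have h1 : ‖a ^ n‖ ^ (1 / n : ℝ) < r := by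
    rw [← ENNReal.ofReal_coe_nnreal] at hn
    exact (ENNReal.ofReal_lt_ofReal_iff_of_nonneg (by positivity)).1 hn
  calc ‖a ^ n‖ = (‖a ^ n‖ ^ (1 / n : ℝ)) ^ n := by
        rw [one_div, Real.rpow_inv_natCast_pow (norm_nonneg _) hn0.ne']
    _ ≤ (r : ℝ) ^ n := pow_le_pow_left₀ (by positivity) h1.le n

theorem integral_comp_of_measurePreserving {α β E : Type*} [MeasurableSpace α] [MeasurableSpace β]
    [NormedAddCommGroup E] [NormedSpace ℝ E] {μ : Measure α} {ν : Measure β} {T : α → β}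
    (hT : MeasurePreserving T μ ν) {f : β → E} (hf : AEStronglyMeasurable f ν) :
    ∫ x, f (T x) ∂μ = ∫ y, f y ∂ν := by
  rw [← hT.map_eq] at hf ⊢
  exact (integral_map hT.measurable.aemeasurable hf).symm

namespace TrimmedBirkhoff

/-! ### Spectral gap of the transfer operator -/

section Transfer

variable {Ω F : Type*} [MeasurableSpace Ω] {μ : Measure Ω} {T : Ω → Ω}

theorem IsTransferImage.comp {S : Ω → Ω} {f g h : Ω → ℂ} (hS : MeasurePreserving S μ μ)
    (hfg : IsTransferImage μ T f g) (hgh : IsTransferImage μ S g h) :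
    IsTransferImage μ (S ∘ T) f h := by
  refine ⟨hfg.1, hgh.2.1, fun u hu => ?_⟩
  rw [hgh.2.2 u hu]
  exact hfg.2.2 (u ∘ S) (hu.comp_measurePreserving hS)

variable [NormedCommRing F] [NormedAlgebra ℂ F] {ι : F →ₗ[ℂ] (Ω →ₘ[μ] ℂ)}

theorem isTransferImage_pow (hT : MeasurePreserving T μ μ) {U : F →L[ℂ] F}
    (hU : ∀ f : F, IsTransferImage μ T (ι f) (ι (U f))) (n : ℕ) (f : F) :
    IsTransferImage μ T^[n] (ι f) (ι ((U ^ n) f)) := by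
  induction n generalizing f with
  | zero => exact ⟨(hU f).1, (hU f).1, fun g _ => by simp⟩
  | succ n ih =>
    rw [Function.iterate_succ, pow_succ]
    exact (hU f).comp (hT.iterate n) (ih (U f))

theorem PropertyC.ae_norm_le (hC : PropertyC μ T ι) (f : F) : ∀ᵐ x ∂μ, ‖ι f x‖ ≤ ‖f‖ := by
  have h := hC.norm_bound f
  rw [eLpNorm_exponent_top] at h
  filter_upwards [enorm_ae_le_eLpNormEssSup (ι f) μ] with x hx
  have := hx.trans h
  rwa [enorm_le_iff_norm_le] at this

theorem coeFn_smul_one (hC : PropertyC μ T ι) (c : ℂ) : ι (c • (1 : F)) =ᵐ[μ] fun _ => c := by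
  rw [map_smul, hC.map_one]
  filter_upwards [AEEqFun.coeFn_smul c (1 : Ω →ₘ[μ] ℂ), AEEqFun.coeFn_one (α := Ω) (β := ℂ) (μ := μ)]
    with x h1 h2
  rw [h1, Pi.smul_apply, h2]; simp

theorem PropertyC.memLp_top (hC : PropertyC μ T ι) (f : F) : MemLp (ι f) ∞ μ :=
  memLp_top_of_bound (ι f).aestronglyMeasurable _ (hC.ae_norm_le f)

variable [IsProbabilityMeasure μ]

theorem PropertyC.integrable (hC : PropertyC μ T ι) (f : F) : Integrable (ι f) μ :=
  (hC.memLp_top f).integrable le_top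

theorem PropertyC.integral_add (hC : PropertyC μ T ι) (f g : F) :
    ∫ x, ι (f + g) x ∂μ = ∫ x, ι f x ∂μ + ∫ x, ι g x ∂μ := by
  rw [← MeasureTheory.integral_add (hC.integrable f) (hC.integrable g), map_add]
  exact integral_congr_ae (AEEqFun.coeFn_add _ _)

theorem PropertyC.integral_smul_one (hC : PropertyC μ T ι) (c : ℂ) :
    ∫ x, ι (c • (1 : F)) x ∂μ = c := by
  rw [integral_congr_ae (coeFn_smul_one hC c)]; simp

theorem PropertyC.norm_integral_le (hC : PropertyC μ T ι) (f : F) :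
    ‖∫ x, ι f x ∂μ‖ ≤ ‖f‖ := by
  simpa using norm_integral_le_of_norm_le_const (hC.ae_norm_le f)

theorem IsTransferImage.integral_eq {f g : Ω → ℂ} (h : IsTransferImage μ T f g) :
    ∫ x, g x ∂μ = ∫ x, f x ∂μ := by
  simpa using h.2.2 (fun _ => 1) (memLp_const _)

/-- Integrable functions with the same integrals against all bounded functions agree a.e. -/
theorem ae_eq_of_forall_integral_mul_eq {f g : Ω → ℂ} (hf : Integrable f μ) (hg : Integrable g μ)
    (h : ∀ u : Ω → ℂ, MemLp u ∞ μ → ∫ x, f x * u x ∂μ = ∫ x, g x * u x ∂μ) : f =ᵐ[μ] g := by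
  refine Integrable.ae_eq_of_forall_setIntegral_eq f g hf hg fun s hs _ => ?_
  have := h (s.indicator fun _ => 1) ((memLp_const (1 : ℂ)).indicator hs)
  rw [← integral_indicator hs, ← integral_indicator hs]
  convert this using 3 with x x <;> by_cases hx : x ∈ s <;> simp [hx]

/-- The transfer operator fixes the constant function `1`. -/
theorem PropertyC.transfer_one (hC : PropertyC μ T ι) {U : F →L[ℂ] F}
    (hU : ∀ f : F, IsTransferImage μ T (ι f) (ι (U f))) : U 1 = 1 := by
  apply hC.injective
  apply AEEqFun.ext
  have h1 : ι (1 : F) =ᵐ[μ] fun _ => (1 : ℂ) := by simpa using coeFn_smul_one hC (1 : ℂ)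
  refine ae_eq_of_forall_integral_mul_eq (hC.integrable _) (hC.integrable _) fun u hu => ?_
  rw [(hU 1).2.2 u hu]
  have e1 : ∫ x, ι (1 : F) x * u (T x) ∂μ = ∫ x, u (T x) ∂μ :=
    integral_congr_ae (by filter_upwards [h1] with x hx; simp [hx])
  have e2 : ∫ x, ι (1 : F) x * u x ∂μ = ∫ x, u x ∂μ :=
    integral_congr_ae (by filter_upwards [h1] with x hx; simp [hx])
  have hT := hC.measurePreserving
  rw [e1, e2, integral_comp_of_measurePreserving hT hu.aestronglyMeasurable]

/-- Eigenvalues of the transfer operator lie in the closed unit disc. -/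
theorem PropertyC.norm_eigenvalue_le_one (hC : PropertyC μ T ι) {U : F →L[ℂ] F}
    (hU : ∀ f : F, IsTransferImage μ T (ι f) (ι (U f))) {c : ℂ} {e : F} (he : e ≠ 0)
    (hce : U e = c • e) : ‖c‖ ≤ 1 := by
  have hT := hC.measurePreserving
  have hm := hC.memLp_top e
  have hconj : MemLp (fun x => (starRingEnd ℂ) (ι e x)) ∞ μ := hm.star
  have hsq : Integrable (fun x => ‖ι e x‖ ^ 2) μ :=
    (hm.mono_exponent le_top).integrable_norm_pow two_ne_zero
  have hsqT : Integrable (fun x => ‖ι e (T x)‖ ^ 2) μ := hT.integrable_comp_of_integrable hsq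
  have hpos : 0 < ∫ x, ‖ι e x‖ ^ 2 ∂μ := by
    refine lt_of_le_of_ne (integral_nonneg fun x => by positivity) fun h0 => he ?_
    have := (integral_eq_zero_iff_of_nonneg (fun x => by positivity) hsq).1 h0.symm
    apply hC.injective
    rw [map_zero]
    apply AEEqFun.ext
    filter_upwards [this, AEEqFun.coeFn_zero (α := Ω) (β := ℂ) (μ := μ)] with x hx h0x
    rw [h0x]
    simpa using hx
  -- Testing duality against the conjugate of e gives c‖e‖₂² = ∫ e · conj(e ∘ T). The right side is
  -- at most ‖e‖₂² in modulus, by 2ab ≤ a² + b² and invariance of the measure.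
  have key := (hU e).2.2 _ hconj
  have hl : ∫ x, ι (U e) x * (starRingEnd ℂ) (ι e x) ∂μ = c * ((∫ x, ‖ι e x‖ ^ 2 ∂μ : ℝ) : ℂ) := by
    rw [← integral_complex_ofReal, ← integral_const_mul]
    refine integral_congr_ae ?_
    rw [hce, map_smul]
    filter_upwards [AEEqFun.coeFn_smul c (ι e)] with x hx
    rw [hx, Pi.smul_apply, smul_eq_mul, mul_assoc, Complex.mul_conj, Complex.normSq_eq_norm_sq]
  have hTint : ∫ x, ‖ι e (T x)‖ ^ 2 ∂μ = ∫ x, ‖ι e x‖ ^ 2 ∂μ :=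
    integral_comp_of_measurePreserving hT hsq.aestronglyMeasurable
  have hr : ‖∫ x, ι e x * (starRingEnd ℂ) (ι e (T x)) ∂μ‖ ≤ ∫ x, ‖ι e x‖ ^ 2 ∂μ := by
    calc _ ≤ ∫ x, (‖ι e x‖ ^ 2 + ‖ι e (T x)‖ ^ 2) / 2 ∂μ := by
          refine norm_integral_le_of_norm_le ((hsq.add hsqT).div_const 2) (ae_of_all _ fun x => ?_)
          rw [norm_mul, RCLike.norm_conj]
          nlinarith [sq_nonneg (‖ι e x‖ - ‖ι e (T x)‖)]
      _ = _ := by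
          rw [integral_div, MeasureTheory.integral_add hsq hsqT, hTint]; ring
  rw [← key, hl, norm_mul, Complex.norm_real, Real.norm_of_nonneg hpos.le] at hr
  nlinarith

/-- The iterates of the transfer operator converge to the expectation, with summable errors. -/
theorem PropertyC.exists_summable_norm_pow_sub [CompleteSpace F] (hC : PropertyC μ T ι) :
    ∃ U : F →L[ℂ] F, (∀ f : F, IsTransferImage μ T (ι f) (ι (U f))) ∧
      ∀ f : F, Summable fun n : ℕ => ‖(U ^ n) f - (∫ x, ι f x ∂μ) • (1 : F)‖ := by
  obtain ⟨U, hU, c, P, N, hUPN, hPP, hrank, hspec, hPN, hNP⟩ := hC.transfer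
  refine ⟨U, hU, ?_⟩
  have hPPa (f : F) : P (P f) = P f := congrArg (· f) hPP
  have hPNa (f : F) : P (N f) = 0 := congrArg (· f) hPN
  have hNPa (f : F) : N (P f) = 0 := congrArg (· f) hNP
  have hUa (f : F) : U f = c • P f + N f := by rw [hUPN]; rfl
  obtain ⟨⟨e, he⟩, he0, hspan⟩ := finrank_eq_one_iff'.1 hrank
  have he0' : e ≠ 0 := fun h => he0 (Subtype.ext h)
  obtain ⟨e', he'⟩ := he
  have he'' : P e' = e := he'
  have hPe : P e = e := by rw [← he'', hPPa]
  have hNe : N e = 0 := by rw [← he'', hNPa]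
  -- A vector e spanning the range of P is an eigenvector of U for c; with |c| ≤ 1 the spectral
  -- radius of N is below 1.
  have hc : ‖c‖ ≤ 1 := hC.norm_eigenvalue_le_one hU he0' (by rw [hUa, hPe, hNe, add_zero])
  have hN : Summable fun n : ℕ => ‖N ^ n‖ := by
    refine summable_norm_pow_of_spectralRadius_lt_one (hspec.trans_le ?_)
    have : ‖c‖ₑ ≤ ENNReal.ofReal 1 := by
      rw [← ofReal_norm]; exact ENNReal.ofReal_le_ofReal hc
    simpa using this
  have hNf (f : F) : Tendsto (fun n : ℕ => (N ^ n) f) atTop (𝓝 0) := by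
    refine squeeze_zero_norm (fun n => (N ^ n).le_opNorm f) ?_
    simpa using hN.tendsto_atTop_zero.mul_const ‖f‖
  have hnt : Nontrivial F := ⟨e, 0, he0'⟩
  have hU1 : U 1 = 1 := hC.transfer_one hU
  have hPU (f : F) : P (U f) = c • P f := by rw [hUa, map_add, map_smul, hPPa, hPNa, add_zero]
  -- Otherwise the powers of N applied to 1 would be constantly N 1 instead of tending to 0. This is
  -- used twice: to exclude P 1 = 0, and, once c = 1 is known, to get P 1 = 1.
  have hN1 (h : N (N 1) = N 1) : N 1 = 0 := by
    have hp (n : ℕ) : (N ^ (n + 1)) 1 = N 1 := by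
      induction n with
      | zero => simp
      | succ n ih => rw [pow_succ', mul_apply_eq_comp, ih, h]
    have := (hNf 1).comp (tendsto_add_atTop_nat 1)
    simp only [Function.comp_def, hp] at this
    exact tendsto_nhds_unique tendsto_const_nhds this
  have hP1 : P 1 ≠ 0 := by
    intro h
    have h1 : N 1 = 1 := by
      have := hUa 1
      rw [hU1, h, smul_zero, zero_add] at this
      exact this.symm
    have := hN1 (by rw [h1, h1])
    rw [h1] at this
    exact one_ne_zero this
  have hc1 : c = 1 := by
    have := hPU 1
    rw [hU1] at this
    have h2 : (c - 1) • P 1 = 0 := by rw [sub_smul, one_smul, ← this, sub_self]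
    exact sub_eq_zero.1 ((smul_eq_zero.1 h2).resolve_right hP1)
  subst hc1
  have hN1' : N 1 = 1 - P 1 := by
    have := hUa 1
    rw [hU1, one_smul] at this
    rw [eq_sub_iff_add_eq']
    exact this.symm
  have hP11 : P 1 = 1 := by
    have h0 := hN1 (by conv_lhs => rw [hN1', map_sub, hNPa, sub_zero])
    rw [hN1', sub_eq_zero] at h0
    exact h0.symm
  have hUn (f : F) (n : ℕ) : (U ^ (n + 1)) f = P f + (N ^ (n + 1)) f := by
    induction n with
    | zero => simp [hUa]
    | succ n ih =>
      rw [pow_succ', mul_apply_eq_comp, ih, hUa, map_add, map_add, hPPa, hNPa,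
        pow_succ' N (n + 1), mul_apply_eq_comp, pow_succ' N n,
        mul_apply_eq_comp, hPNa, one_smul, add_zero, zero_add]
  -- The range of P is the line of constants. The constant is the mean of f, because U preserves
  -- integrals and the contribution of the powers of N vanishes in the limit.
  have hPf (f : F) : P f = (∫ x, ι f x ∂μ) • (1 : F) := by
    obtain ⟨a, ha⟩ := hspan ⟨P 1, 1, rfl⟩
    obtain ⟨b, hb⟩ := hspan ⟨P f, f, rfl⟩
    have ha' : a • e = 1 := by rw [← hP11]; exact congrArg Subtype.val ha
    have hb' : b • e = P f := congrArg Subtype.val hb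
    have ha0 : a ≠ 0 := by
      rintro rfl
      rw [zero_smul] at ha'
      exact zero_ne_one ha'
    have hPs : P f = (b / a) • (1 : F) := by
      rw [← ha', smul_smul, div_mul_cancel₀ _ ha0, hb']
    have hint (n : ℕ) : ∫ x, ι f x ∂μ = b / a + ∫ x, ι ((N ^ (n + 1)) f) x ∂μ := by
      rw [← (isTransferImage_pow hC.measurePreserving hU (n + 1) f).integral_eq, hUn,
        hC.integral_add, hPs, hC.integral_smul_one]
    have ht : Tendsto (fun n : ℕ => ∫ x, ι ((N ^ (n + 1)) f) x ∂μ) atTop (𝓝 0) :=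
      squeeze_zero_norm (fun n => hC.norm_integral_le _)
        (tendsto_zero_iff_norm_tendsto_zero.1 ((hNf f).comp (tendsto_add_atTop_nat 1)))
    have h1 : Tendsto (fun _ : ℕ => ∫ x, ι f x ∂μ) atTop (𝓝 (b / a + 0)) := by
      refine (ht.const_add (b / a)).congr fun n => (hint n).symm
    rw [tendsto_nhds_unique tendsto_const_nhds h1, add_zero, hPs]
  intro f
  -- The zeroth term is dropped because U ^ n = P + N ^ n holds only for n ≥ 1.
  rw [← summable_nat_add_iff 1]
  refine Summable.of_nonneg_of_le (fun _ => norm_nonneg _) (fun n => ?_)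
    (((summable_nat_add_iff 1).2 hN).mul_right ‖f‖)
  rw [hUn, hPf, add_sub_cancel_left]
  exact (N ^ (n + 1)).le_opNorm f

end Transfer

/-! ### Strong law of large numbers from summable correlations -/

section StrongLaw

variable {Ω F : Type*} [MeasurableSpace Ω] {μ : Measure Ω} [IsProbabilityMeasure μ] {T : Ω → Ω}

theorem measurable_birkhoffSum {S : Ω → Ω} (hS : Measurable S) {ψ : Ω → ℝ} (hψ : Measurable ψ)
    (n : ℕ) : Measurable (birkhoffSum S ψ n) :=
  Finset.measurable_fun_sum _ fun k _ => hψ.comp (hS.iterate k)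

theorem norm_birkhoffSum_le {α : Type*} {T : α → α} {ψ : α → ℝ} {B : ℝ}
    (hB : ∀ x, ‖ψ x‖ ≤ B) (n : ℕ) (x : α) :
    ‖birkhoffSum T ψ n x‖ ≤ n * B := by
  simpa [birkhoffSum] using norm_sum_le_of_le (Finset.range n) fun k _ => hB (T^[k] x)

/-- If the autocorrelations are summable, the second moment of the Birkhoff sums grows at most
linearly. -/
theorem integral_birkhoffSum_sq_le (hT : MeasurePreserving T μ μ) {ψ : Ω → ℝ} (hψ : Measurable ψ)
    {B : ℝ} (hB : ∀ x, ‖ψ x‖ ≤ B) (hc : Summable fun k : ℕ => |∫ x, ψ x * ψ (T^[k] x) ∂μ|) (n : ℕ) :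
    ∫ x, birkhoffSum T ψ n x ^ 2 ∂μ ≤ n * (2 * ∑' k : ℕ, |∫ x, ψ x * ψ (T^[k] x) ∂μ|) := by
  have hint {u : Ω → ℝ} (hu : Measurable u) {D : ℝ} (hD : ∀ x, ‖u x‖ ≤ D) : Integrable u μ :=
    .of_bound hu.aestronglyMeasurable D (ae_of_all _ hD)
  set c : ℕ → ℝ := fun k => ∫ x, ψ x * ψ (T^[k] x) ∂μ with hcdef
  have hprod (k : ℕ) : Integrable (fun x => ψ x * ψ (T^[k] x)) μ :=
    hint (hψ.mul (hψ.comp (hT.measurable.iterate k))) (D := B * B) fun x => by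
      rw [norm_mul]
      exact mul_le_mul (hB _) (hB _) (norm_nonneg _) ((norm_nonneg _).trans (hB x))
  have hsq (n : ℕ) : Integrable (fun x => birkhoffSum T ψ n x ^ 2) μ :=
    hint ((measurable_birkhoffSum hT.measurable hψ n).pow_const 2) (D := (n * B) ^ 2) fun x => by
      rw [norm_pow]
      exact pow_le_pow_left₀ (norm_nonneg _) (norm_birkhoffSum_le hB n x) 2
  induction n with
  | zero => simp [birkhoffSum_zero]
  | succ n ih =>
    -- Splitting off the first summand makes the cross terms exactly the autocorrelations at lags 1,
    -- …, n.
    have hexp (x : Ω) : birkhoffSum T ψ (n + 1) x ^ 2 = birkhoffSum T ψ n (T x) ^ 2 +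
        (2 * ∑ k ∈ Finset.range n, ψ x * ψ (T^[k + 1] x) + ψ x * ψ (T^[0] x)) := by
      rw [birkhoffSum_succ', ← Finset.mul_sum]
      simp only [birkhoffSum, Function.iterate_succ_apply, Function.iterate_zero, id]
      ring
    have hshift : ∫ x, birkhoffSum T ψ n (T x) ^ 2 ∂μ = ∫ x, birkhoffSum T ψ n x ^ 2 ∂μ :=
      integral_comp_of_measurePreserving hT (hsq n).aestronglyMeasurable
    have hsum : Integrable (fun x => ∑ k ∈ Finset.range n, ψ x * ψ (T^[k + 1] x)) μ :=
      integrable_finsetSum _ fun k _ => hprod (k + 1)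
    have hstep : ∫ x, birkhoffSum T ψ (n + 1) x ^ 2 ∂μ = ∫ x, birkhoffSum T ψ n x ^ 2 ∂μ +
        (2 * ∑ k ∈ Finset.range n, c (k + 1) + c 0) := by
      simp_rw [hexp]
      have hT2 : Integrable (fun x => birkhoffSum T ψ n (T x) ^ 2) μ :=
        hT.integrable_comp_of_integrable (hsq n)
      have hs2 : Integrable (fun x => 2 * ∑ k ∈ Finset.range n, ψ x * ψ (T^[k + 1] x) +
          ψ x * ψ (T^[0] x)) μ := (hsum.const_mul 2).add (hprod 0)
      rw [MeasureTheory.integral_add hT2 hs2,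
        MeasureTheory.integral_add (hsum.const_mul 2) (hprod 0), integral_const_mul,
        integral_finsetSum _ fun k _ => hprod (k + 1), hshift]
    have hbound : ∑ k ∈ Finset.range n, |c (k + 1)| + |c 0| ≤ ∑' k, |c k| := by
      rw [← Finset.sum_range_succ' (fun k => |c k|)]
      exact hc.sum_le_tsum _ fun _ _ => abs_nonneg _
    have h1 : ∑ k ∈ Finset.range n, c (k + 1) ≤ ∑ k ∈ Finset.range n, |c (k + 1)| :=
      Finset.sum_le_sum fun k _ => le_abs_self _
    rw [hstep]
    push_cast
    linarith [le_abs_self (c 0), abs_nonneg (c 0)]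

/-- A strong law of large numbers for bounded observables with summable correlations. -/
theorem tendsto_birkhoffSum_div_of_summable_correlation (hT : MeasurePreserving T μ μ)
    {φ : Ω → ℝ} (hφ : Measurable φ) (h0 : ∀ x, 0 ≤ φ x) {B : ℝ} (hB : ∀ x, φ x ≤ B)
    (hc : Summable fun k : ℕ => |∫ x, φ x * φ (T^[k] x) ∂μ - (∫ x, φ x ∂μ) ^ 2|) :
    ∀ᵐ x ∂μ, Tendsto (fun n : ℕ => birkhoffSum T φ n x / n) atTop (𝓝 (∫ x, φ x ∂μ)) := by
  set m := ∫ x, φ x ∂μ with hm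
  have hint {u : Ω → ℝ} (hu : Measurable u) {D : ℝ} (hD : ∀ x, ‖u x‖ ≤ D) : Integrable u μ :=
    .of_bound hu.aestronglyMeasurable D (ae_of_all _ hD)
  have hφB (x : Ω) : ‖φ x‖ ≤ B := by rw [Real.norm_of_nonneg (h0 x)]; exact hB x
  have hφint := hint hφ hφB
  set ψ : Ω → ℝ := fun x => φ x - m with hψdef
  have hψ : Measurable ψ := hφ.sub_const m
  have hψB (x : Ω) : ‖ψ x‖ ≤ B + ‖m‖ := (norm_sub_le _ _).trans (by linarith [hφB x])
  have hcorr (k : ℕ) : ∫ x, ψ x * ψ (T^[k] x) ∂μ = ∫ x, φ x * φ (T^[k] x) ∂μ - m ^ 2 := by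
    have hk := hT.iterate k
    have hφk : Integrable (fun x => φ (T^[k] x)) μ := hk.integrable_comp_of_integrable hφint
    have hφφ : Integrable (fun x => φ x * φ (T^[k] x)) μ :=
      hint (hφ.mul (hφ.comp hk.measurable)) (D := B * B) fun x => by
        rw [norm_mul]
        exact mul_le_mul (hφB _) (hφB _) (norm_nonneg _) ((norm_nonneg _).trans (hφB x))
    have hmk : ∫ x, φ (T^[k] x) ∂μ = m :=
      integral_comp_of_measurePreserving hk hφ.aestronglyMeasurable
    have ha : Integrable (fun x => m * φ x + m * φ (T^[k] x)) μ :=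
      (hφint.const_mul m).add (hφk.const_mul m)
    have hs : Integrable (fun x => m * φ x + m * φ (T^[k] x) - m ^ 2) μ :=
      ha.sub (integrable_const _)
    have hexp (x : Ω) : ψ x * ψ (T^[k] x) =
        φ x * φ (T^[k] x) - (m * φ x + m * φ (T^[k] x) - m ^ 2) := by
      simp only [hψdef]; ring
    simp_rw [hexp]
    rw [integral_sub hφφ hs, integral_sub ha (integrable_const _),
      MeasureTheory.integral_add (hφint.const_mul m) (hφk.const_mul m), integral_const_mul,
      integral_const_mul, hmk, ← hm]
    simp only [integral_const, probReal_univ, smul_eq_mul, one_mul]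
    ring
  simp_rw [← hcorr] at hc
  have hsum (n : ℕ) (x : Ω) : birkhoffSum T ψ n x = birkhoffSum T φ n x - n * m := by
    simp [birkhoffSum, hψdef, Finset.sum_sub_distrib]
  set C := 2 * ∑' k : ℕ, |∫ x, ψ x * ψ (T^[k] x) ∂μ|
  -- Along the squares the second moment of the average is at most C / n², hence summable. At n = 0
  -- both sides are 0, as division by zero gives 0.
  have hmom (n : ℕ) : ∫⁻ x, ENNReal.ofReal ((birkhoffSum T ψ (n ^ 2) x / (n ^ 2 : ℕ)) ^ 2) ∂μ ≤
      ENNReal.ofReal (C * (1 / (n : ℝ) ^ 2)) := by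
    have hS := measurable_birkhoffSum hT.measurable hψ (n ^ 2)
    have hI : Integrable (fun x => birkhoffSum T ψ (n ^ 2) x ^ 2) μ :=
      hint (hS.pow_const 2) (D := ((n ^ 2 : ℕ) * (B + ‖m‖)) ^ 2) fun x => by
        rw [norm_pow]
        exact pow_le_pow_left₀ (norm_nonneg _) (norm_birkhoffSum_le hψB _ x) 2
    simp_rw [div_pow]
    rw [← ofReal_integral_eq_lintegral_ofReal (hI.div_const _)
      (ae_of_all _ fun x => by positivity), integral_div]
    refine ENNReal.ofReal_le_ofReal ?_
    have := integral_birkhoffSum_sq_le hT hψ hψB hc (n ^ 2)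
    rcases Nat.eq_zero_or_pos n with rfl | hn
    · simp
    · have hn' : (0 : ℝ) < n := by exact_mod_cast hn
      rw [div_le_iff₀ (by positivity)]
      refine this.trans (le_of_eq ?_)
      push_cast
      field_simp
      rfl
  have hfin : ∑' n : ℕ, ∫⁻ x, ENNReal.ofReal
      ((birkhoffSum T ψ (n ^ 2) x / (n ^ 2 : ℕ)) ^ 2) ∂μ ≠ ∞ := by
    refine ne_top_of_le_ne_top ?_ (ENNReal.tsum_le_tsum hmom)
    exact ((Real.summable_one_div_nat_pow.2 one_lt_two).mul_left C).tsum_ofReal_ne_top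
  have hmeas (n : ℕ) : Measurable fun x =>
      ENNReal.ofReal ((birkhoffSum T ψ (n ^ 2) x / (n ^ 2 : ℕ)) ^ 2) :=
    (((measurable_birkhoffSum hT.measurable hψ _).div_const _).pow_const 2).ennreal_ofReal
  rw [← lintegral_tsum fun n => (hmeas n).aemeasurable] at hfin
  filter_upwards [ae_lt_top (Measurable.tsum hmeas) hfin] with x hx
  have ht := ENNReal.tendsto_atTop_zero_of_tsum_ne_top hx.ne
  have ht2 : Tendsto (fun n : ℕ => (birkhoffSum T ψ (n ^ 2) x / (n ^ 2 : ℕ)) ^ 2) atTop (𝓝 0) := by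
    have := (ENNReal.tendsto_toReal ENNReal.zero_ne_top).comp ht
    simpa [Function.comp_def, ENNReal.toReal_ofReal, sq_nonneg] using this
  have ht3 : Tendsto (fun n : ℕ => birkhoffSum T ψ (n ^ 2) x / (n ^ 2 : ℕ)) atTop (𝓝 0) := by
    rw [tendsto_zero_iff_abs_tendsto_zero]
    have := ht2.sqrt
    simpa only [Function.comp_def, Real.sqrt_sq_eq_abs, Real.sqrt_zero] using this
  -- Since φ ≥ 0 the Birkhoff sums increase in n, so convergence along the squares suffices:
  -- consecutive squares have ratio tending to 1.
  refine tendsto_div_of_monotone_of_exists_subseq_tendsto_div _ _ ?_ fun a ha =>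
    ⟨fun n => n ^ 2, ?_, tendsto_pow_atTop two_ne_zero, ?_⟩
  · refine monotone_nat_of_le_succ fun n => ?_
    rw [birkhoffSum_succ]
    linarith [h0 (T^[n] x)]
  · have h1 : Tendsto (fun n : ℕ => (1 + 1 / (n : ℝ)) ^ 2) atTop (𝓝 ((1 + 0) ^ 2)) :=
      (tendsto_one_div_atTop_nhds_zero_nat.const_add 1).pow 2
    filter_upwards [h1.eventually_lt_const (by simpa using ha), eventually_gt_atTop 0] with n hn hn0
    have hn' : (0 : ℝ) < n := by exact_mod_cast hn0
    have : ((n : ℝ) + 1) ^ 2 = (1 + 1 / (n : ℝ)) ^ 2 * n ^ 2 := by field_simp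
    push_cast
    rw [this]
    exact mul_le_mul_of_nonneg_right hn.le (by positivity)
  · have h1 := ht3.add_const m
    rw [zero_add] at h1
    refine h1.congr' ?_
    filter_upwards [eventually_gt_atTop 0] with n hn
    have hn' : (n : ℝ) ≠ 0 := by exact_mod_cast hn.ne'
    rw [hsum]
    push_cast
    field_simp
    ring

variable [NormedCommRing F] [NormedAlgebra ℂ F] [CompleteSpace F] {ι : F →ₗ[ℂ] (Ω →ₘ[μ] ℂ)}

/-- Bounded nonnegative observables which represent an element of `F` satisfy the strong law of
large numbers. -/
theorem PropertyC.tendsto_birkhoffSum_div (hC : PropertyC μ T ι) {φ : Ω → ℝ} (hφ : Measurable φ)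
    (h0 : ∀ x, 0 ≤ φ x) {B : ℝ} (hB : ∀ x, φ x ≤ B) {f : F}
    (hf : ι f =ᵐ[μ] fun x => ((φ x : ℝ) : ℂ)) :
    ∀ᵐ x ∂μ, Tendsto (fun n : ℕ => birkhoffSum T φ n x / n) atTop (𝓝 (∫ x, φ x ∂μ)) := by
  have hT := hC.measurePreserving
  refine tendsto_birkhoffSum_div_of_summable_correlation hT hφ h0 hB ?_
  obtain ⟨U, hU, hsum⟩ := hC.exists_summable_norm_pow_sub
  refine Summable.of_nonneg_of_le (fun _ => abs_nonneg _) (fun n => ?_) ((hsum f).mul_right B)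
  set m := ∫ x, φ x ∂μ with hm
  have hIf : ∫ x, ι f x ∂μ = (m : ℂ) := by
    rw [integral_congr_ae hf, integral_complex_ofReal]
  have hφtop : MemLp (fun x => ((φ x : ℝ) : ℂ)) ∞ μ := by
    refine memLp_top_of_bound (Complex.measurable_ofReal.comp hφ).aestronglyMeasurable B
      (ae_of_all _ fun x => ?_)
    rw [Complex.norm_real, Real.norm_of_nonneg (h0 x)]
    exact hB x
  have hφint : Integrable (fun x => ((φ x : ℝ) : ℂ)) μ := hφtop.integrable le_top
  have hcorr : ∫ x, ι ((U ^ n) f) x * φ x ∂μ = ((∫ x, φ x * φ (T^[n] x) ∂μ : ℝ) : ℂ) := by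
    rw [(isTransferImage_pow hT hU n f).2.2 _ hφtop, ← integral_complex_ofReal]
    refine integral_congr_ae ?_
    filter_upwards [hf] with x hx
    rw [hx, Complex.ofReal_mul]
  -- By duality the correlation pairs φ with the error of the n-th iterate. The norm of `F`
  -- dominates the essential supremum, so it is at most that error's norm times B.
  have hdiff : ((∫ x, φ x * φ (T^[n] x) ∂μ - m ^ 2 : ℝ) : ℂ) =
      ∫ x, ι ((U ^ n) f - (∫ x, ι f x ∂μ) • (1 : F)) x * φ x ∂μ := by
    have hmm : ((m ^ 2 : ℝ) : ℂ) = ∫ x, (m : ℂ) * φ x ∂μ := by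
      rw [integral_const_mul, integral_complex_ofReal, ← hm]; push_cast; ring
    have hi : Integrable (fun x => ι ((U ^ n) f) x * φ x) μ := by
      refine Integrable.mul_bdd (hC.integrable _) hφtop.aestronglyMeasurable
        (c := B) (ae_of_all _ fun x => ?_)
      rw [Complex.norm_real, Real.norm_of_nonneg (h0 x)]
      exact hB x
    rw [Complex.ofReal_sub, ← hcorr, hmm, ← integral_sub hi (hφint.const_mul _)]
    refine integral_congr_ae ?_
    rw [hIf, map_sub]
    filter_upwards [AEEqFun.coeFn_sub (ι ((U ^ n) f)) (ι ((m : ℂ) • (1 : F))),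
      coeFn_smul_one hC (m : ℂ)] with x h1 h2
    rw [h1, Pi.sub_apply, h2, sub_mul]
  rw [← Real.norm_eq_abs, ← Complex.norm_real, hdiff]
  refine (norm_integral_le_of_norm_le_const (C := _ * B) ?_).trans_eq
    (by rw [probReal_univ, mul_one])
  filter_upwards [hC.ae_norm_le ((U ^ n) f - (∫ x, ι f x ∂μ) • (1 : F))] with x hx
  rw [norm_mul, Complex.norm_real, Real.norm_of_nonneg (h0 x)]
  exact mul_le_mul hx (hB x) (h0 x) (norm_nonneg _)

end StrongLaw

/-! ### Slow diagonal sequences -/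

/-- A family of sequences which converge to zero almost surely can be run through so slowly that
the diagonal sequence converges to zero almost surely, at a given rate. -/
theorem exists_slow_diagonal {Ω : Type*} [MeasurableSpace Ω] {μ : Measure Ω} [IsFiniteMeasure μ]
    {X : ℕ → ℕ → Ω → ℝ} (hX : ∀ j n, Measurable (X j n))
    (hlim : ∀ j, ∀ᵐ x ∂μ, Tendsto (fun n => X j n x) atTop (𝓝 0))
    {ε : ℕ → ℝ} (hε : ∀ j, 0 < ε j) (M : ℕ → ℕ) :
    ∃ J : ℕ → ℕ, Tendsto J atTop atTop ∧ (∀ᶠ n in atTop, M (J n) ≤ n) ∧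
      ∀ᵐ x ∂μ, ∀ᶠ n in atTop, |X (J n) n x| < ε (J n) := by
  let A : ℕ → ℕ → Set Ω := fun j N => ⋃ n ≥ N, {x | ε j ≤ |X j n x|}
  have hA (j N : ℕ) : MeasurableSet (A j N) :=
    .iUnion fun n => .iUnion fun _ => measurableSet_le measurable_const (hX j n).abs
  have hanti (j : ℕ) : Antitone (A j) := fun N N' h =>
    Set.biUnion_subset_biUnion_left fun n hn => le_trans h hn
  have hmemA (j N n : ℕ) (x : Ω) (hn : N ≤ n) (hx : x ∉ A j N) : |X j n x| < ε j := by
    by_contra! h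
    exact hx (Set.mem_biUnion (show n ∈ {n | n ≥ N} from hn) h)
  have hnull (j : ℕ) : μ (⋂ N, A j N) = 0 := by
    rw [measure_eq_zero_iff_ae_notMem]
    filter_upwards [hlim j] with x hx hmem
    have hev : ∀ᶠ n in atTop, |X j n x| < ε j := by
      have := hx.abs
      rw [abs_zero] at this
      exact this.eventually_lt_const (hε j)
    obtain ⟨N, hN⟩ := eventually_atTop.1 hev
    obtain ⟨n, hn, hle⟩ := Set.mem_iUnion₂.1 (Set.mem_iInter.1 hmem N)
    exact absurd (hN n hn) (not_lt.2 hle)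
  -- The bound 2^(-j) serves Borel–Cantelli; j ≤ N keeps the search bound n in the definition of J
  -- from cutting off admissible j.
  have hex (j : ℕ) : ∃ N, M j ≤ N ∧ j ≤ N ∧ μ (A j N) ≤ ENNReal.ofReal ((1 / 2) ^ j) := by
    have ht := tendsto_measure_iInter_atTop (μ := μ) (fun N => (hA j N).nullMeasurableSet)
      (hanti j) ⟨0, measure_ne_top _ _⟩
    rw [hnull j] at ht
    have := ht.eventually_lt_const (u := ENNReal.ofReal ((1 / 2) ^ j)) (by simp)
    obtain ⟨N, h1, h2, h3⟩ := (this.and ((eventually_ge_atTop (M j)).and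
      (eventually_ge_atTop j))).exists
    exact ⟨N, h2, h3, h1.le⟩
  choose N hNM hNj hNA using hex
  have hbc : ∀ᵐ x ∂μ, ∀ᶠ j in atTop, x ∉ A j (N j) := by
    refine ae_eventually_notMem (ne_top_of_le_ne_top ?_ (ENNReal.tsum_le_tsum hNA))
    exact (summable_geometric_of_lt_one (by norm_num) (by norm_num)).tsum_ofReal_ne_top
  let J : ℕ → ℕ := fun n => Nat.findGreatest (fun j => N j ≤ n) n
  have hJ : Tendsto J atTop atTop := by
    refine tendsto_atTop.2 fun j => ?_
    filter_upwards [eventually_ge_atTop (N j)] with n hn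
    exact Nat.le_findGreatest ((hNj j).trans hn) hn
  -- Before time N 0 no index need be admissible, and `Nat.findGreatest` may return its default 0.
  have hNJ : ∀ᶠ n in atTop, N (J n) ≤ n := by
    filter_upwards [eventually_ge_atTop (N 0)] with n hn
    exact Nat.findGreatest_spec (P := fun j => N j ≤ n) (Nat.zero_le n) hn
  refine ⟨J, hJ, hNJ.mono fun n hn => (hNM _).trans hn, ?_⟩
  filter_upwards [hbc] with x hx
  filter_upwards [hJ.eventually hx, hNJ] with n h1 h2
  exact hmemA _ _ _ _ h2 h1

/-! ### Trimming a decreasing tuple -/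

section Trimming

variable {n b : ℕ} {t : Fin n → ℝ} {l : ℝ}

/-- By monotonicity the k + 1 entries up to index k all exceed l. -/
theorem lt_of_antitone_of_card_le (ht : Antitone t)
    (hcard : (Finset.univ.filter fun k => l < t k).card ≤ b) {k : Fin n} (hk : l < t k) :
    (k : ℕ) < b := by
  have hsub : Finset.Iic k ⊆ Finset.univ.filter fun k => l < t k := fun i hi => by
    simp only [Finset.mem_filter, Finset.mem_univ, true_and]
    exact hk.trans_le (ht (Finset.mem_Iic.1 hi))
  have := (Finset.card_le_card hsub).trans hcard
  rw [Fin.card_Iic] at this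
  omega

/-- The sum of a decreasing tuple without its first `b` entries, compared with the sum of the
entries up to `l`. -/
theorem sum_trimmed_le (ht : Antitone t) (h0 : ∀ k, 0 ≤ t k)
    (hcard : (Finset.univ.filter fun k => l < t k).card ≤ b) :
    ∑ k : Fin n with b ≤ k.val, t k ≤ ∑ k : Fin n with t k ≤ l, t k := by
  refine Finset.sum_le_sum_of_subset_of_nonneg (fun k hk => ?_) fun k _ _ => h0 k
  simp only [Finset.mem_filter, Finset.mem_univ, true_and] at hk ⊢
  by_contra! h
  exact absurd (lt_of_antitone_of_card_le ht hcard h) (not_lt.2 hk)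

/-- The only loss comes from the set D of trimmed entries that are at most l. D and the exceedances
are disjoint sets of indices below b, which bounds the size of D. -/
theorem sum_le_sum_trimmed_add (ht : Antitone t) (h0 : ∀ k, 0 ≤ t k) (hl : 0 ≤ l)
    (hcard : (Finset.univ.filter fun k => l < t k).card ≤ b) :
    ∑ k : Fin n with t k ≤ l, t k ≤ ∑ k : Fin n with b ≤ k.val, t k +
      (b - (Finset.univ.filter fun k => l < t k).card) * l := by
  set E := Finset.univ.filter fun k => l < t k
  set D := Finset.univ.filter fun k : Fin n => t k ≤ l ∧ (k : ℕ) < b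
  have hsub : (Finset.univ.filter fun k => t k ≤ l) ⊆
      (Finset.univ.filter fun k : Fin n => b ≤ k.val) ∪ D := fun k hk => by
    simp only [D, Finset.mem_union, Finset.mem_filter, Finset.mem_univ, true_and] at hk ⊢
    rcases le_or_gt b k.val with h | h
    exacts [.inl h, .inr ⟨hk, h⟩]
  have hdisj : Disjoint (Finset.univ.filter fun k : Fin n => b ≤ k.val) D :=
    Finset.disjoint_filter.2 fun k _ h1 h2 => absurd h2.2 (not_lt.2 h1)
  have hDE : Disjoint D E := Finset.disjoint_filter.2 fun k _ h1 h2 => absurd h1.1 (not_le.2 h2)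
  have hDcard : D.card + E.card ≤ b := by
    rw [← Finset.card_union_of_disjoint hDE, ← Finset.card_range b]
    refine Finset.card_le_card_of_injOn (fun k => (k : ℕ)) (fun k hk => ?_)
      (Fin.val_injective.injOn)
    simp only [D, E, Finset.coe_union, Finset.coe_filter, Set.mem_union, Set.mem_ofPred_eq,
      Finset.mem_univ, true_and] at hk
    rcases hk with hk | hk
    · simpa using hk.2
    · simpa using lt_of_antitone_of_card_le ht hcard hk
  have hD : ∑ k ∈ D, t k ≤ D.card * l := by
    rw [← nsmul_eq_mul]
    exact Finset.sum_le_card_nsmul _ _ _ fun k hk => (Finset.mem_filter.1 hk).2.1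
  have hDcard' : (D.card : ℝ) ≤ b - E.card := by
    have : (D.card : ℝ) + E.card ≤ b := by exact_mod_cast hDcard
    linarith
  calc ∑ k : Fin n with t k ≤ l, t k
      ≤ ∑ k ∈ (Finset.univ.filter fun k : Fin n => b ≤ k.val) ∪ D, t k :=
        Finset.sum_le_sum_of_subset_of_nonneg hsub fun k _ _ => h0 k
    _ = ∑ k : Fin n with b ≤ k.val, t k + ∑ k ∈ D, t k := Finset.sum_union hdisj
    _ ≤ _ := by gcongr; exact hD.trans (mul_le_mul_of_nonneg_right hDcard' hl)

end Trimming

/-! ### Trimmed sums versus Birkhoff sums of truncations -/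

section TrimmedSum

variable {Ω : Type*} {T : Ω → Ω} {χ : Ω → ℝ}

theorem antitone_comp_sort (n : ℕ) (x : Ω) : Antitone fun k : Fin n =>
    χ (T^[(Tuple.sort (fun j : Fin n => -χ (T^[(j : ℕ)] x)) k : ℕ)] x) := fun _ _ h =>
  neg_le_neg_iff.1 (Tuple.monotone_sort (fun j : Fin n => -χ (T^[(j : ℕ)] x)) h)

theorem sum_comp_sort_le (n : ℕ) (l : ℝ) (x : Ω) :
    ∑ k : Fin n with χ (T^[(Tuple.sort (fun j : Fin n => -χ (T^[(j : ℕ)] x)) k : ℕ)] x) ≤ l,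
      χ (T^[(Tuple.sort (fun j : Fin n => -χ (T^[(j : ℕ)] x)) k : ℕ)] x) =
    birkhoffSum T (Set.indicator {y | χ y ≤ l} χ) n x := by
  rw [Finset.sum_filter, Equiv.sum_comp (Tuple.sort (fun j : Fin n => -χ (T^[(j : ℕ)] x)))
    (fun j : Fin n => if χ (T^[(j : ℕ)] x) ≤ l then χ (T^[(j : ℕ)] x) else 0),
    Fin.sum_univ_eq_sum_range (fun j => if χ (T^[j] x) ≤ l then χ (T^[j] x) else 0), birkhoffSum]
  simp [Set.indicator_apply]

theorem card_comp_sort_lt (n : ℕ) (l : ℝ) (x : Ω) :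
    ((Finset.univ.filter fun k : Fin n => l <
      χ (T^[(Tuple.sort (fun j : Fin n => -χ (T^[(j : ℕ)] x)) k : ℕ)] x)).card : ℝ) =
    birkhoffSum T (Set.indicator {y | l < χ y} fun _ => (1 : ℝ)) n x := by
  rw [Finset.card_filter, Nat.cast_sum,
    Equiv.sum_comp (Tuple.sort (fun j : Fin n => -χ (T^[(j : ℕ)] x)))
    (fun j : Fin n => (((if l < χ (T^[(j : ℕ)] x) then 1 else 0) : ℕ) : ℝ)),
    Fin.sum_univ_eq_sum_range (fun j => (((if l < χ (T^[j] x) then 1 else 0) : ℕ) : ℝ)),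
    birkhoffSum]
  simp [Set.indicator_apply]

variable {l : ℝ} {b n : ℕ} {x : Ω}

theorem trimmedSum_le (h0 : ∀ x, 0 ≤ χ x)
    (hb : birkhoffSum T (Set.indicator {y | l < χ y} fun _ => (1 : ℝ)) n x ≤ b) :
    trimmedSum T χ b n x ≤ birkhoffSum T (Set.indicator {y | χ y ≤ l} χ) n x := by
  rw [← card_comp_sort_lt, Nat.cast_le] at hb
  rw [← sum_comp_sort_le]
  exact sum_trimmed_le (antitone_comp_sort n x) (fun _ => h0 _) hb

theorem le_trimmedSum_add (h0 : ∀ x, 0 ≤ χ x) (hl : 0 ≤ l)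
    (hb : birkhoffSum T (Set.indicator {y | l < χ y} fun _ => (1 : ℝ)) n x ≤ b) :
    birkhoffSum T (Set.indicator {y | χ y ≤ l} χ) n x ≤ trimmedSum T χ b n x +
      (b - birkhoffSum T (Set.indicator {y | l < χ y} fun _ => (1 : ℝ)) n x) * l := by
  rw [← card_comp_sort_lt] at hb ⊢
  rw [Nat.cast_le] at hb
  rw [← sum_comp_sort_le]
  exact sum_le_sum_trimmed_add (antitone_comp_sort n x) (fun _ => h0 _) hl hb

end TrimmedSum

/-! ### Truncations and exceedances of the observable -/

section Truncation

variable {Ω F : Type*} [MeasurableSpace Ω] {μ : Measure Ω} {T : Ω → Ω} {χ : Ω → ℝ}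

theorem indicator_le_nonneg {α : Type*} {χ : α → ℝ} (h0 : ∀ x, 0 ≤ χ x) (l : ℝ) (x : α) :
    0 ≤ Set.indicator {y | χ y ≤ l} χ x := Set.indicator_nonneg (fun _ _ => h0 _) x

theorem indicator_le_le {α : Type*} {χ : α → ℝ} {l : ℝ} (hl : 0 ≤ l) (x : α) :
    Set.indicator {y | χ y ≤ l} χ x ≤ l := Set.indicator_apply_le' (fun h => h) fun _ => hl

theorem measurable_indicator_le (hχ : Measurable χ) (l : ℝ) :
    Measurable (Set.indicator {y | χ y ≤ l} χ) :=
  hχ.indicator (measurableSet_le hχ measurable_const)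

theorem measurable_indicator_lt (hχ : Measurable χ) (l : ℝ) :
    Measurable (Set.indicator {y | l < χ y} fun _ => (1 : ℝ)) :=
  measurable_const.indicator (measurableSet_lt measurable_const hχ)

variable [IsProbabilityMeasure μ]

theorem integrable_indicator_le (hχ : Measurable χ) (h0 : ∀ x, 0 ≤ χ x) {l : ℝ} (hl : 0 ≤ l) :
    Integrable (Set.indicator {y | χ y ≤ l} χ) μ := by
  refine .of_bound (measurable_indicator_le hχ l).aestronglyMeasurable l (ae_of_all _ fun x => ?_)
  rw [Real.norm_of_nonneg (indicator_le_nonneg h0 l x)]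
  exact indicator_le_le hl x

theorem integral_indicator_le_mono (hχ : Measurable χ) (h0 : ∀ x, 0 ≤ χ x) {l l' : ℝ} (hl : 0 ≤ l)
    (hll' : l ≤ l') : ∫ x, Set.indicator {y | χ y ≤ l} χ x ∂μ ≤
      ∫ x, Set.indicator {y | χ y ≤ l'} χ x ∂μ :=
  integral_mono (integrable_indicator_le hχ h0 hl)
    (integrable_indicator_le hχ h0 (hl.trans hll')) fun x =>
      Set.indicator_le_indicator_of_subset (fun _ h => le_trans h hll') (fun _ => h0 _) x

/-- Some truncation of a nonnegative function which does not vanish has a positive integral. -/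
theorem exists_integral_indicator_le_pos (hχ : Measurable χ) (h0 : ∀ x, 0 ≤ χ x)
    (hne : ¬ χ =ᵐ[μ] 0) : ∃ l : ℕ, 0 < ∫ x, Set.indicator {y | χ y ≤ l} χ x ∂μ := by
  by_contra! h
  refine hne ?_
  have hz (l : ℕ) : Set.indicator {y | χ y ≤ l} χ =ᵐ[μ] 0 := by
    rw [← integral_eq_zero_iff_of_nonneg (indicator_le_nonneg h0 l)
      (integrable_indicator_le hχ h0 l.cast_nonneg)]
    exact le_antisymm (h l) (integral_nonneg (indicator_le_nonneg h0 l))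
  filter_upwards [ae_all_iff.2 hz] with x hx
  obtain ⟨l, hl⟩ := exists_nat_ge (χ x)
  simpa [Set.indicator_of_mem (show x ∈ {y | χ y ≤ l} from hl)] using hx l

theorem tendsto_integral_indicator_lt (hχ : Measurable χ) {L : ℕ → ℝ} (hL : Tendsto L atTop atTop) :
    Tendsto (fun j => ∫ x, Set.indicator {y | L j < χ y} (fun _ => (1 : ℝ)) x ∂μ) atTop (𝓝 0) := by
  rw [← integral_zero Ω ℝ (μ := μ)]
  refine tendsto_integral_of_dominated_convergence (fun _ => 1)
    (fun j => (measurable_indicator_lt hχ _).aestronglyMeasurable) (integrable_const _)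
    (fun j => ae_of_all _ fun x => ?_) (ae_of_all _ fun x => ?_)
  · refine (norm_indicator_le_norm_self _ x).trans (by simp)
  · refine tendsto_const_nhds.congr' ?_
    filter_upwards [hL.eventually_ge_atTop (χ x)] with j hj
    exact (Set.indicator_of_notMem (s := {y | L j < χ y}) (not_lt.2 hj) _).symm

variable [NormedCommRing F] [NormedAlgebra ℂ F] [CompleteSpace F] {ι : F →ₗ[ℂ] (Ω →ₘ[μ] ℂ)}

theorem PropertyD.tendsto_truncation (hD : PropertyD μ T ι χ) {l : ℝ} (hl : 0 < l) :
    ∀ᵐ x ∂μ, Tendsto (fun n : ℕ => birkhoffSum T (Set.indicator {y | χ y ≤ l} χ) n x / n) atTop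
      (𝓝 (∫ x, Set.indicator {y | χ y ≤ l} χ x ∂μ)) := by
  obtain ⟨K, -, hK⟩ := hD.truncation
  obtain ⟨f, hf, -⟩ := hK l hl
  exact hD.propertyC.tendsto_birkhoffSum_div (measurable_indicator_le hD.measurable l)
    (indicator_le_nonneg hD.nonneg l) (indicator_le_le hl.le) hf

theorem PropertyD.tendsto_exceedance (hD : PropertyD μ T ι χ) {l : ℝ} (hl : 0 < l) :
    ∀ᵐ x ∂μ, Tendsto
      (fun n : ℕ => birkhoffSum T (Set.indicator {y | l < χ y} fun _ => (1 : ℝ)) n x / n) atTop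
      (𝓝 (∫ x, Set.indicator {y | l < χ y} (fun _ => (1 : ℝ)) x ∂μ)) := by
  obtain ⟨K, -, hK⟩ := hD.indicator
  obtain ⟨f, hf, -⟩ := hK l hl
  refine hD.propertyC.tendsto_birkhoffSum_div (f := f) (B := 1)
    (measurable_indicator_lt hD.measurable l)
    (fun x => Set.indicator_nonneg (fun _ _ => zero_le_one) x)
    (fun x => Set.indicator_apply_le' (fun _ => le_rfl) fun _ => zero_le_one) ?_
  filter_upwards [hf] with x hx
  rw [hx]
  by_cases h : l < χ x <;> simp [h]

end Truncation

/-- If the truncated Birkhoff sums and the numbers of exceedances are close to their means, so is the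
trimmed sum for a slightly larger number of trimmed entries. -/
theorem abs_trimmedSum_sub_le {Ω : Type*} {T : Ω → Ω} {χ : Ω → ℝ} (h0 : ∀ x, 0 ≤ χ x)
    {l ε p m : ℝ} (hl : 1 ≤ l) {n : ℕ} (hn : 1 ≤ n * ε) (hp : 0 ≤ p) {x : Ω}
    (hm : |birkhoffSum T (Set.indicator {y | χ y ≤ l} χ) n x - n * m| ≤ n * ε)
    (hc : |birkhoffSum T (Set.indicator {y | l < χ y} fun _ => (1 : ℝ)) n x - n * p| ≤ n * ε) :
    |trimmedSum T χ (⌈n * (p + ε)⌉₊ + 1) n x - n * m| ≤ 5 * (n * ε) * l := by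
  rw [abs_le] at hm hc
  have hb1 : n * (p + ε) ≤ ⌈n * (p + ε)⌉₊ := Nat.le_ceil _
  have hb2 : (⌈n * (p + ε)⌉₊ : ℝ) < n * (p + ε) + 1 := by
    refine Nat.ceil_lt_add_one ?_
    rw [mul_add]
    have : (0 : ℝ) ≤ n * p := by positivity
    linarith
  have hb : birkhoffSum T (Set.indicator {y | l < χ y} fun _ => (1 : ℝ)) n x ≤
      (⌈n * (p + ε)⌉₊ + 1 : ℕ) := by
    push_cast
    linarith
  have hu := trimmedSum_le h0 hb
  have hlo := le_trimmedSum_add h0 (zero_le_one.trans hl) hb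
  -- The surplus is at most 2nε + 2, where the 2 comes from the ceiling and the extra 1; it is at
  -- most 4nε since nε ≥ 1. The fifth nε in the conclusion is the deviation of the truncated sum.
  have hgap : (((⌈n * (p + ε)⌉₊ + 1 : ℕ) : ℝ) -
      birkhoffSum T (Set.indicator {y | l < χ y} fun _ => (1 : ℝ)) n x) * l ≤
        (4 * (n * ε)) * l := by
    refine mul_le_mul_of_nonneg_right ?_ (zero_le_one.trans hl)
    push_cast
    linarith
  have hεl : n * ε ≤ n * ε * l := le_mul_of_one_le_right (zero_le_one.trans hn) hl
  rw [abs_le]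
  constructor <;> linarith

end TrimmedBirkhoff

/-! ### Choice of levels and conclusion -/

theorem corollary1p3 {Ω F : Type*} [MeasurableSpace Ω] (μ : Measure Ω) [IsProbabilityMeasure μ]
    (T : Ω → Ω) [NormedCommRing F] [NormedAlgebra ℂ F] [CompleteSpace F]
    (ι : F →ₗ[ℂ] (Ω →ₘ[μ] ℂ)) (χ : Ω → ℝ)
    (hD : TrimmedBirkhoff.PropertyD μ T ι χ) (hχ : ¬ χ =ᵐ[μ] 0) :
    ∃ (b : ℕ → ℕ) (d : ℕ → ℝ),
      (∀ n, 0 < b n) ∧ Tendsto b atTop atTop ∧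
      (fun n => (b n : ℝ)) =o[atTop] (fun n => (n : ℝ)) ∧
      (∀ n, 0 < d n) ∧
      ∀ᵐ x ∂μ,
        Tendsto (fun n => TrimmedBirkhoff.trimmedSum T χ (b n) n x / d n) atTop (𝓝 1) := by
  have h0 := hD.nonneg
  have hmeas := hD.measurable
  have hT := hD.propertyC.measurePreserving.measurable
  obtain ⟨l₀, hl₀⟩ := TrimmedBirkhoff.exists_integral_indicator_le_pos hmeas h0 hχ
  -- Starting above l₀ keeps every truncated mean at least c > 0.
  let L : ℕ → ℝ := fun j => l₀ + (j + 1)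
  have hL1 (j : ℕ) : 1 ≤ L j := by
    simp only [L]
    linarith [l₀.cast_nonneg (α := ℝ), j.cast_nonneg (α := ℝ)]
  have hL0 (j : ℕ) : 0 < L j := zero_lt_one.trans_le (hL1 j)
  have hL : Tendsto L atTop atTop :=
    tendsto_atTop_add_const_left _ _ (tendsto_atTop_add_const_right _ _ tendsto_natCast_atTop_atTop)
  let u : ℕ → Ω → ℝ := fun j => Set.indicator {y | χ y ≤ L j} χ
  let v : ℕ → Ω → ℝ := fun j => Set.indicator {y | L j < χ y} fun _ => (1 : ℝ)
  let m : ℕ → ℝ := fun j => ∫ x, u j x ∂μ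
  let p : ℕ → ℝ := fun j => ∫ x, v j x ∂μ
  set c : ℝ := ∫ x, Set.indicator {y | χ y ≤ l₀} χ x ∂μ
  have hcm (j : ℕ) : c ≤ m j := TrimmedBirkhoff.integral_indicator_le_mono hmeas h0 l₀.cast_nonneg
    (by simp only [L]; linarith [j.cast_nonneg (α := ℝ)])
  have hm0 (j : ℕ) : 0 < m j := hl₀.trans_le (hcm j)
  have hp0 (j : ℕ) : 0 ≤ p j :=
    integral_nonneg fun x => Set.indicator_nonneg (fun _ _ => zero_le_one) x
  have hp : Tendsto p atTop (𝓝 0) := TrimmedBirkhoff.tendsto_integral_indicator_lt hmeas hL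
  -- Chosen so that ε j · L j = 1 / (j + 1) tends to 0.
  let ε : ℕ → ℝ := fun j => 1 / ((j + 1) * L j)
  have hε (j : ℕ) : 0 < ε j := by have := hL0 j; positivity
  have hεL (j : ℕ) : ε j * L j = 1 / ((j : ℝ) + 1) := by
    have := (hL0 j).ne'
    simp only [ε]
    field_simp
  have hεle (j : ℕ) : ε j ≤ 1 / ((j : ℝ) + 1) := by
    rw [← hεL]
    exact le_mul_of_one_le_right (hε j).le (hL1 j)
  have hone : Tendsto (fun j : ℕ => 1 / ((j : ℝ) + 1)) atTop (𝓝 0) :=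
    tendsto_one_div_add_atTop_nhds_zero_nat
  have hε0 : Tendsto ε atTop (𝓝 0) := squeeze_zero (fun j => (hε j).le) hεle hone
  -- A level is used only once nε ≥ j + 1: this forces b → ∞ and lets nε absorb rounding.
  have hM (j : ℕ) : ∃ M : ℕ, ∀ n : ℕ, M ≤ n → (j : ℝ) + 1 ≤ n * ε j := by
    obtain ⟨M, hM⟩ := exists_nat_ge (((j : ℝ) + 1) / ε j)
    refine ⟨M, fun n hn => ?_⟩
    rw [← div_le_iff₀ (hε j)]
    exact hM.trans (by exact_mod_cast hn)
  choose M hM using hM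
  obtain ⟨J, hJ, hJM, hae⟩ := TrimmedBirkhoff.exists_slow_diagonal (μ := μ)
    (X := fun j n x => |birkhoffSum T (u j) n x / n - m j| + |birkhoffSum T (v j) n x / n - p j|)
    (fun j n => by
      refine Measurable.add ?_ ?_
      · exact (((TrimmedBirkhoff.measurable_birkhoffSum hT
          (TrimmedBirkhoff.measurable_indicator_le hmeas _) n).div_const _).sub_const _).abs
      · exact (((TrimmedBirkhoff.measurable_birkhoffSum hT
          (TrimmedBirkhoff.measurable_indicator_lt hmeas _) n).div_const _).sub_const _).abs)
    (fun j => by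
      filter_upwards [hD.tendsto_truncation (hL0 j), hD.tendsto_exceedance (hL0 j)] with x h1 h2
      have h3 := (h1.sub_const (m j)).abs.add (h2.sub_const (p j)).abs
      simpa only [u, v, m, p, sub_self, abs_zero, add_zero] using h3)
    hε M
  have hnε : ∀ᶠ n : ℕ in atTop, (J n : ℝ) + 1 ≤ n * ε (J n) := hJM.mono fun n hn => hM _ _ hn
  -- The maximum with 1 only keeps d positive at n = 0.
  refine ⟨fun n => ⌈n * (p (J n) + ε (J n))⌉₊ + 1, fun n => (max n 1 : ℕ) * m (J n),
    fun n => Nat.succ_pos _, ?_, ?_, fun n => ?_, ?_⟩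
  · refine tendsto_atTop_mono' _ ?_ hJ
    filter_upwards [hnε] with n hn
    have h1 := Nat.le_ceil ((n : ℝ) * (p (J n) + ε (J n)))
    have h2 : (0 : ℝ) ≤ n * p (J n) := mul_nonneg n.cast_nonneg (hp0 _)
    have h3 : (J n : ℝ) ≤ (⌈n * (p (J n) + ε (J n))⌉₊ + 1 : ℕ) := by
      push_cast
      linarith
    exact_mod_cast h3
  · rw [isLittleO_iff_tendsto' (by
      filter_upwards [eventually_gt_atTop 0] with n hn h
      exact absurd h (by exact_mod_cast hn.ne'))]
    -- Two of the three ε absorb the rounding term 2 ≤ 2nε.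
    have hlim : Tendsto (fun n => p (J n) + 3 * ε (J n)) atTop (𝓝 0) := by
      simpa using (hp.comp hJ).add ((hε0.comp hJ).const_mul 3)
    refine squeeze_zero' (.of_forall fun n => by positivity) ?_ hlim
    filter_upwards [hnε, eventually_gt_atTop 0] with n hn hn0
    have hn0' : (0 : ℝ) < n := by exact_mod_cast hn0
    have h1 : (⌈(n : ℝ) * (p (J n) + ε (J n))⌉₊ : ℝ) < n * (p (J n) + ε (J n)) + 1 :=
      Nat.ceil_lt_add_one (mul_nonneg hn0'.le (add_nonneg (hp0 _) (hε _).le))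
    rw [div_le_iff₀ hn0']
    push_cast
    linarith [(J n).cast_nonneg (α := ℝ)]
  · exact mul_pos (by exact_mod_cast lt_max_of_lt_right Nat.one_pos) (hm0 _)
  · filter_upwards [hae] with x hx
    have hlim : Tendsto (fun n => 5 / c * (1 / ((J n : ℝ) + 1))) atTop (𝓝 0) := by
      simpa using (hone.comp hJ).const_mul (5 / c)
    rw [tendsto_iff_norm_sub_tendsto_zero]
    refine squeeze_zero' (.of_forall fun n => norm_nonneg _) ?_ hlim
    filter_upwards [hx, hnε, eventually_ge_atTop 1] with n hxn hn hn1
    have hn0' : (0 : ℝ) < n := by exact_mod_cast hn1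
    rw [abs_of_nonneg (by positivity)] at hxn
    have hscale {s q : ℝ} (h : |s / n - q| ≤ ε (J n)) : |s - n * q| ≤ n * ε (J n) := by
      rw [show s - n * q = n * (s / n - q) by field_simp, abs_mul, abs_of_pos hn0']
      exact mul_le_mul_of_nonneg_left h hn0'.le
    have key := TrimmedBirkhoff.abs_trimmedSum_sub_le (T := T) h0 (hL1 (J n)) (ε := ε (J n))
      (by linarith [(J n).cast_nonneg (α := ℝ)]) (hp0 (J n))
      (hscale (by linarith [abs_nonneg (birkhoffSum T (v (J n)) n x / n - p (J n))]) :
        |birkhoffSum T (u (J n)) n x - n * m (J n)| ≤ _)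
      (hscale (by linarith [abs_nonneg (birkhoffSum T (u (J n)) n x / n - m (J n))]))
    have hnm : (0 : ℝ) < n * m (J n) := mul_pos hn0' (hm0 _)
    rw [max_eq_left hn1, div_sub_one hnm.ne', norm_div, Real.norm_eq_abs, Real.norm_of_nonneg hnm.le,
      div_le_iff₀ hnm]
    refine key.trans ?_
    rw [mul_assoc 5, mul_assoc (n : ℝ), hεL]
    calc 5 * (n * (1 / ((J n : ℝ) + 1))) = 5 / c * (1 / ((J n : ℝ) + 1)) * (n * c) := by
          field_simp
      _ ≤ _ := by
          gcongr
          exact hcm _
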